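/- Let $\mathbb D$ be the open unit disc in $\mathbb C$, let $dA=\frac1\pi r\,dr\,d\theta$ be the normalized area measure on $\mathbb D$, let $A^2$ be the Bergman space, i.e. the closed subspace of $L^2(\mathbb D,dA)$ consisting of the analytic functions, and let $P:L^2(\mathbb D,dA)\to A^2$ be the orthogonal projection. For $\varphi\in L^\infty(\mathbb D)$ let $M_\varphi f=\varphi f$, let $T_\varphi=PM_\varphi:A^2\to A^2$ be the Toeplitz operator and $H_\varphi=(I-P)M_\varphi:A^2\to L^2(\mathbb D,dA)$ the Hankel operator with symbol $\varphi$, and let $AQ(\mathbb D)$ be the set of all $\varphi\in L^\infty(\mathbb D)$ such that $H_\varphi$ is compact. Theorem 5.6. Suppose that $\varphi\in C(\overline{\mathbb D})\cap AQ(\mathbb D)$, i.e. $\varphi:\overline{\mathbb D}\to\mathbb C$ is continuous and its Hankel operator $H_\varphi$ is compact, and that $$\operatorname{Re}\varphi(z)\ \ge\ |\operatorname{Im}\varphi(z)|^2\qquad\text{for all } z\in\mathbb D.$$ Then $T_\varphi$ is invertible on $A^2$ if and only if it is a Fredholm operator. -/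

import Mathlib

noncomputable section

namespace BergmanToeplitz

open MeasureTheory Metric Set Filter Topology
open scoped ENNReal

/-- The normalized area measure `dA = π⁻¹ r dr dθ` on the open unit disc, as a measure on `ℂ`
carried by the disc. -/
def diskArea : Measure ℂ :=
  (ENNReal.ofReal Real.pi)⁻¹ • (volume : Measure ℂ).restrict (ball 0 1)

instance : IsProbabilityMeasure diskArea := by
  constructor
  have h : (NNReal.pi : ℝ≥0∞) = ENNReal.ofReal Real.pi := by
    rw [← NNReal.coe_real_pi, ENNReal.ofReal_coe_nnreal]
  have h0 : ENNReal.ofReal Real.pi ≠ 0 := by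
    simpa using Real.pi_pos
  simp only [diskArea, Measure.smul_apply, Measure.restrict_apply_univ, Complex.volume_ball,
    smul_eq_mul, ENNReal.ofReal_one, one_pow, one_mul, h]
  exact ENNReal.inv_mul_cancel h0 ENNReal.ofReal_ne_top

/-- An identity holding almost everywhere for the planar measure on the disc holds
almost everywhere for `diskArea`, and conversely. -/
theorem ae_diskArea_iff {p : ℂ → Prop} :
    (∀ᵐ z ∂diskArea, p z) ↔ ∀ᵐ z ∂(volume : Measure ℂ).restrict (ball 0 1), p z := by
  have h1 : (ENNReal.ofReal Real.pi)⁻¹ ≠ 0 := ENNReal.inv_ne_zero.2 ENNReal.ofReal_ne_top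
  rw [diskArea, ae_iff, ae_iff, Measure.smul_apply, smul_eq_mul, mul_eq_zero]
  simp [h1]

/-- The Bergman space `A²` of the disc: the subspace of `L²` of the (classes of) functions that
are holomorphic on the disc. -/
def bergmanSpace : Submodule ℂ (Lp ℂ 2 diskArea) where
  carrier := {f | ∃ g : ℂ → ℂ, DifferentiableOn ℂ g (ball 0 1) ∧ f =ᵐ[diskArea] g}
  add_mem' := by
    rintro f₁ f₂ ⟨g₁, h₁, e₁⟩ ⟨g₂, h₂, e₂⟩
    exact ⟨g₁ + g₂, h₁.add h₂, (Lp.coeFn_add f₁ f₂).trans (e₁.add e₂)⟩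
  zero_mem' := ⟨0, differentiableOn_const 0, Lp.coeFn_zero ℂ 2 diskArea⟩
  smul_mem' := by
    rintro c f ⟨g, h, e⟩
    exact ⟨c • g, h.const_smul c, (Lp.coeFn_smul c f).trans (e.const_smul c)⟩

/-- A local sub-mean value estimate over discs for holomorphic functions. -/
theorem enorm_mul_le_lintegral_ball {f : ℂ → ℂ} (hf : DifferentiableOn ℂ f (ball 0 1))
    {z : ℂ} {r : ℝ} (hr : 0 < r) (hz : closedBall z r ⊆ ball 0 1) :
    ‖f z‖ₑ * (ENNReal.ofReal (r / 2) * ENNReal.ofReal (r / 2)) ≤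
      ∫⁻ w in ball z r, ‖f w‖ₑ := by
  classical
  set F : ℂ → ℝ≥0∞ := (ball z r).piecewise (fun w => ‖f w‖ₑ) (fun _ => 0) with hF
  have hFm : Measurable F := by
    refine ContinuousOn.measurable_piecewise ?_ continuousOn_const measurableSet_ball
    exact (hf.continuousOn.mono (ball_subset_closedBall.trans hz)).enorm
  have e1 : ∫⁻ w in ball z r, ‖f w‖ₑ = ∫⁻ w, F (w + z) := by
    rw [lintegral_add_right_eq_self (fun w => F w) z, ← lintegral_indicator measurableSet_ball]
    rfl
  have hsymm : Measurable fun p : ℝ × ℝ => Complex.polarCoord.symm p := by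
    simp only [Complex.polarCoord_symm_apply]
    fun_prop
  have hm : Measurable fun p : ℝ × ℝ =>
      ENNReal.ofReal p.1 • F (Complex.polarCoord.symm p + z) := by
    simp only [smul_eq_mul]
    exact (ENNReal.measurable_ofReal.comp measurable_fst).mul
      (hFm.comp (hsymm.add_const z))
  have key : ∀ s ∈ Ioo (r / 2) r,
      ‖f z‖ₑ * ENNReal.ofReal (r / 2) ≤
        ∫⁻ θ in Ioo (-Real.pi) Real.pi,
          ENNReal.ofReal s • F (Complex.polarCoord.symm (s, θ) + z) := by
    intro s hs
    have hs0 : 0 < s := by linarith [hs.1]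
    have hmean : Real.circleAverage f z s = f z := by
      apply DiffContOnCl.circleAverage
      apply DifferentiableOn.diffContOnCl
      apply hf.mono
      rw [abs_of_pos hs0]
      exact closure_ball_subset_closedBall.trans ((closedBall_subset_closedBall hs.2.le).trans hz)
    have hint : f z = ((2 * Real.pi)⁻¹ : ℝ) • ∫ θ in Ioo (-Real.pi) Real.pi,
        f (circleMap z s θ) := by
      have hper : Function.Periodic (fun θ => f (circleMap z s θ)) (2 * Real.pi) :=
        fun θ => by simp only [periodic_circleMap z s θ]
      have := hper.intervalIntegral_add_eq 0 (-Real.pi)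
      rw [zero_add, show -Real.pi + 2 * Real.pi = Real.pi by ring] at this
      rw [← hmean, Real.circleAverage_def, this,
        intervalIntegral.integral_of_le (by linarith [Real.pi_pos]),
        integral_Ioc_eq_integral_Ioo]
    have hle : ‖f z‖ₑ ≤ ∫⁻ θ in Ioo (-Real.pi) Real.pi, ‖f (circleMap z s θ)‖ₑ := by
      calc ‖f z‖ₑ = ‖((2 * Real.pi)⁻¹ : ℝ)‖ₑ *
            ‖∫ θ in Ioo (-Real.pi) Real.pi, f (circleMap z s θ)‖ₑ := by
              conv_lhs => rw [hint]
              rw [enorm_smul]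
        _ ≤ 1 * ∫⁻ θ in Ioo (-Real.pi) Real.pi, ‖f (circleMap z s θ)‖ₑ := by
              gcongr
              · rw [Real.enorm_eq_ofReal (by positivity)]
                apply ENNReal.ofReal_le_one.2
                apply inv_le_one_of_one_le₀
                linarith [Real.pi_gt_three]
              · exact enorm_integral_le_lintegral_enorm _
        _ = _ := one_mul _
    have hcm : ∀ θ, F (Complex.polarCoord.symm (s, θ) + z) = ‖f (circleMap z s θ)‖ₑ := by
      intro θ
      have h1 : Complex.polarCoord.symm (s, θ) + z = circleMap z s θ := by
        rw [Complex.polarCoord_symm_apply, circleMap, Complex.exp_mul_I]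
        push_cast
        ring
      have h2 : circleMap z s θ ∈ ball z r := by
        rw [mem_ball, dist_eq_norm, circleMap_sub_center, norm_circleMap_zero, abs_of_pos hs0]
        exact hs.2
      rw [h1, hF, piecewise_eq_of_mem _ _ _ h2]
    simp only [hcm, smul_eq_mul]
    rw [lintegral_const_mul' _ _ ENNReal.ofReal_ne_top, mul_comm]
    gcongr
    exact hs.1.le
  rw [e1, ← Complex.lintegral_comp_polarCoord_symm, polarCoord_target]
  have e2 : (volume : Measure (ℝ × ℝ)).restrict (Ioi (0 : ℝ) ×ˢ Ioo (-Real.pi) Real.pi) =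
      ((volume : Measure ℝ).restrict (Ioi 0)).prod
        ((volume : Measure ℝ).restrict (Ioo (-Real.pi) Real.pi)) := by
    rw [Measure.prod_restrict, Measure.volume_eq_prod]
  rw [e2, lintegral_prod _ hm.aemeasurable]
  calc ‖f z‖ₑ * (ENNReal.ofReal (r / 2) * ENNReal.ofReal (r / 2))
      = ∫⁻ _s in Ioo (r / 2) r, ‖f z‖ₑ * ENNReal.ofReal (r / 2) := by
        rw [setLIntegral_const, Real.volume_Ioo, show r - r / 2 = r / 2 by ring, mul_assoc]
    _ ≤ ∫⁻ s in Ioo (r / 2) r, ∫⁻ θ in Ioo (-Real.pi) Real.pi,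
          ENNReal.ofReal s • F (Complex.polarCoord.symm (s, θ) + z) :=
        setLIntegral_mono' measurableSet_Ioo key
    _ ≤ _ := lintegral_mono_set fun s hs => by
        have : r / 2 < s := hs.1
        exact mem_Ioi.2 (by linarith)

/-- Point evaluations are bounded on the Bergman space, locally uniformly on the disc. -/
theorem enorm_mul_le_eLpNorm {f : ℂ → ℂ} (hf : DifferentiableOn ℂ f (ball 0 1))
    {z : ℂ} {r : ℝ} (hr : 0 < r) (hz : closedBall z r ⊆ ball 0 1) :
    ‖f z‖ₑ * (ENNReal.ofReal (r / 2) * ENNReal.ofReal (r / 2)) ≤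
      ENNReal.ofReal Real.pi * eLpNorm f 2 diskArea := by
  have h0 : ENNReal.ofReal Real.pi ≠ 0 := by simpa using Real.pi_pos
  have hms : AEStronglyMeasurable f diskArea :=
    (hf.continuousOn.aestronglyMeasurable measurableSet_ball).smul_measure _
  calc _ ≤ ∫⁻ w in ball z r, ‖f w‖ₑ := enorm_mul_le_lintegral_ball hf hr hz
    _ ≤ ∫⁻ w in ball 0 1, ‖f w‖ₑ := lintegral_mono_set (ball_subset_closedBall.trans hz)
    _ = ENNReal.ofReal Real.pi * eLpNorm f 1 diskArea := by
        rw [eLpNorm_one_eq_lintegral_enorm, diskArea, lintegral_smul_measure, smul_eq_mul,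
          ← mul_assoc, ENNReal.mul_inv_cancel h0 ENNReal.ofReal_ne_top, one_mul]
    _ ≤ _ := by
        gcongr
        exact eLpNorm_le_eLpNorm_of_exponent_le (by norm_num) hms

theorem isClosed_bergmanSpace : IsClosed (bergmanSpace : Set (Lp ℂ 2 diskArea)) := by
  apply IsSeqClosed.isClosed
  intro x f hx hlim
  choose g hg hxg using hx
  have hdist : ∀ m n, eLpNorm (g m - g n) 2 diskArea = edist (x m) (x n) := by
    intro m n
    rw [Lp.edist_def]
    exact eLpNorm_congr_ae ((hxg m).symm.sub (hxg n).symm)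
  have hcau := hlim.cauchySeq
  have huc : ∀ K ⊆ ball (0 : ℂ) 1, IsCompact K → UniformCauchySeqOn g atTop K := by
    intro K hK hKc
    obtain ⟨δ, hδ, hsub⟩ := hKc.exists_cthickening_subset_open isOpen_ball hK
    set c : ℝ≥0∞ := ENNReal.ofReal (δ / 2) * ENNReal.ofReal (δ / 2) with hc
    have hc0 : c ≠ 0 := by
      have : ENNReal.ofReal (δ / 2) ≠ 0 := by simpa using hδ
      exact mul_ne_zero this this
    have hct : c ≠ ∞ := ENNReal.mul_ne_top ENNReal.ofReal_ne_top ENNReal.ofReal_ne_top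
    intro u hu
    obtain ⟨ε, hε, hεu⟩ := mem_uniformity_edist.1 hu
    set P := ENNReal.ofReal Real.pi with hP
    have hP0 : P ≠ 0 := by simpa [hP] using Real.pi_pos
    have hPt : P ≠ ∞ := ENNReal.ofReal_ne_top
    have hε' : 0 < ε * c / P :=
      ENNReal.div_pos (mul_ne_zero hε.ne' hc0) hPt
    obtain ⟨N, hN⟩ := EMetric.cauchySeq_iff.1 hcau _ hε'
    filter_upwards [(eventually_ge_atTop N).prod_mk (eventually_ge_atTop N)]
    rintro ⟨m, n⟩ ⟨hm, hn⟩ z hz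
    apply hεu
    have hzb : closedBall z δ ⊆ ball 0 1 :=
      (closedBall_subset_cthickening hz δ).trans hsub
    have h1 := enorm_mul_le_eLpNorm ((hg m).sub (hg n)) hδ hzb
    rw [hdist m n, ← hc, ← hP] at h1
    have h2 : P * edist (x m) (x n) < ε * c := by
      have := hN m hm n hn
      rw [ENNReal.lt_div_iff_mul_lt (Or.inl hP0) (Or.inl hPt)] at this
      rwa [mul_comm]
    have h3 : ‖(g m - g n) z‖ₑ * c < ε * c := h1.trans_lt h2
    rw [edist_eq_enorm_sub]
    exact lt_of_mul_lt_mul_right' h3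
  have hpt : ∀ z ∈ ball (0 : ℂ) 1, ∃ l, Tendsto (fun n => g n z) atTop (𝓝 l) := by
    intro z hz
    exact cauchySeq_tendsto_of_complete
      ((huc {z} (singleton_subset_iff.2 hz) isCompact_singleton).cauchySeq rfl)
  choose! G hG using hpt
  have hloc : TendstoLocallyUniformlyOn g G atTop (ball 0 1) := by
    rw [tendstoLocallyUniformlyOn_iff_forall_isCompact isOpen_ball]
    intro K hK hKc
    exact (huc K hK hKc).tendstoUniformlyOn_of_tendsto fun z hz => hG z (hK hz)
  refine ⟨G, hloc.differentiableOn (Eventually.of_forall hg) isOpen_ball, ?_⟩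
  obtain ⟨ns, hns, hae⟩ := (tendstoInMeasure_of_tendsto_Lp hlim).exists_seq_tendsto_ae
  have hball : ∀ᵐ z ∂diskArea, z ∈ ball (0 : ℂ) 1 :=
    ae_diskArea_iff.2 (ae_restrict_mem measurableSet_ball)
  filter_upwards [hae, hball, ae_all_iff.2 hxg] with z h1 h2 h3
  have h4 : Tendsto (fun i => x (ns i) z) atTop (𝓝 (G z)) := by
    simp only [h3]
    exact (hG z h2).comp hns.tendsto_atTop
  exact tendsto_nhds_unique h1 h4

instance : CompleteSpace bergmanSpace := isClosed_bergmanSpace.completeSpace_coe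

/-- The multiplication operator `M_φ : L² → L²`, `f ↦ φ f`, for `φ ∈ L^∞`. -/
def mulOp (φ : Lp ℂ ∞ diskArea) : Lp ℂ 2 diskArea →L[ℂ] Lp ℂ 2 diskArea :=
  (ContinuousLinearMap.mul ℂ ℂ).holderL diskArea ∞ 2 2 φ

/-- The Bergman projection `P`, the orthogonal projection of `L²` onto `A²`. -/
def bergmanProj : Lp ℂ 2 diskArea →L[ℂ] bergmanSpace :=
  bergmanSpace.orthogonalProjectionOnto

/-- The Toeplitz operator `T_φ = P M_φ : A² → A²`. -/
def toeplitz (φ : Lp ℂ ∞ diskArea) : bergmanSpace →L[ℂ] bergmanSpace :=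
  bergmanProj ∘L mulOp φ ∘L bergmanSpace.subtypeL

/-- The Hankel operator `H_φ = (I - P) M_φ : A² → L²`. -/
def hankel (φ : Lp ℂ ∞ diskArea) : bergmanSpace →L[ℂ] Lp ℂ 2 diskArea :=
  (ContinuousLinearMap.id ℂ (Lp ℂ 2 diskArea) - bergmanSpace.subtypeL ∘L bergmanProj) ∘L
    mulOp φ ∘L bergmanSpace.subtypeL

/-- `AQ(𝔻)`: the symbols in `L^∞` whose Hankel operator is compact. -/
def AQ : Set (Lp ℂ ∞ diskArea) :=
  {φ | IsCompactOperator (hankel φ)}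

theorem memLp_top_of_continuousOn {φ : ℂ → ℂ} (hφ : ContinuousOn φ (closedBall 0 1)) :
    MemLp φ ∞ diskArea := by
  obtain ⟨C, hC⟩ := (isCompact_closedBall (0 : ℂ) 1).exists_bound_of_continuousOn hφ
  have hm : AEStronglyMeasurable φ diskArea :=
    ((hφ.mono ball_subset_closedBall).aestronglyMeasurable measurableSet_ball).smul_measure _
  refine memLp_top_of_bound hm C (ae_diskArea_iff.2 ?_)
  filter_upwards [ae_restrict_mem measurableSet_ball] with z hz
  exact hC z (ball_subset_closedBall hz)

/-- The element of `L^∞` given by a function that is continuous on the closed disc. -/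
def symbol (φ : ℂ → ℂ) (hφ : ContinuousOn φ (closedBall 0 1)) : Lp ℂ ∞ diskArea :=
  (memLp_top_of_continuousOn hφ).toLp φ

end BergmanToeplitz

end

noncomputable section

namespace BergmanToeplitz

open MeasureTheory Metric Set Filter Topology
open scoped ENNReal

/-! Everything rests on the quadratic form `⟨f, T f⟩ = ∫ φ |f|² dA`. Its real part integrates the
nonnegative function `Re φ |f|²`, so if the form vanishes at `f`, then `Re φ` is zero almost
everywhere that `f` is not. The bound `|Im φ|² ≤ Re φ` then removes `Im φ` as well, so `φ f = 0`
(`mul_ae_eq_zero_of_inner_toeplitz_eq_zero`). If `f ≠ 0`, its zeros are isolated and continuity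
gives `φ = 0` on the disc (`eqOn_zero_of_mul_ae_eq_zero`), hence `T = 0`, which is not Fredholm
because `A²` is infinite-dimensional.

So for Fredholm `T` the form vanishes only at `0`. Both the kernel and the orthogonal complement of
the range consist of zeros of the form, hence are trivial; since the range is closed, `T` is
bijective. -/

theorem ae_mem_ball : ∀ᵐ z ∂diskArea, z ∈ ball (0 : ℂ) 1 :=
  ae_diskArea_iff.2 (ae_restrict_mem measurableSet_ball)

theorem coeFn_mulOp (φ : Lp ℂ ∞ diskArea) (f : Lp ℂ 2 diskArea) :
    mulOp φ f =ᵐ[diskArea] fun z => φ z * f z := by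
  exact (ContinuousLinearMap.mul ℂ ℂ).coeFn_holder (r := 2) φ f

theorem coeFn_symbol (φ : ℂ → ℂ) (hφ : ContinuousOn φ (closedBall 0 1)) :
    symbol φ hφ =ᵐ[diskArea] φ :=
  (memLp_top_of_continuousOn hφ).coeFn_toLp

theorem coeFn_mulOp_symbol (φ : ℂ → ℂ) (hφ : ContinuousOn φ (closedBall 0 1))
    (f : Lp ℂ 2 diskArea) : mulOp (symbol φ hφ) f =ᵐ[diskArea] fun z => φ z * f z := by
  filter_upwards [coeFn_mulOp (symbol φ hφ) f, coeFn_symbol φ hφ] with z h1 h2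
  rw [h1, h2]

/-- The projection is self-adjoint and fixes `f`, so it drops out of the pairing. -/
theorem inner_toeplitz (φ : Lp ℂ ∞ diskArea) (f g : bergmanSpace) :
    inner ℂ f (toeplitz φ g) = inner ℂ (f : Lp ℂ 2 diskArea) (mulOp φ (g : Lp ℂ 2 diskArea)) :=
  bergmanSpace.inner_orthogonalProjectionOnto_eq_of_mem_left f _

/-- A symbol with values in the region `|Im w|² ≤ Re w` has nonnegative real part, and vanishes
wherever its real part does. So the quadratic form of its Toeplitz operator vanishes only at those
functions that the symbol annihilates. -/
theorem mul_ae_eq_zero_of_inner_toeplitz_eq_zero {φ : ℂ → ℂ}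
    (hφ : ContinuousOn φ (closedBall 0 1))
    (hcond : ∀ z ∈ ball (0 : ℂ) 1, |(φ z).im| ^ 2 ≤ (φ z).re) {f : bergmanSpace}
    (hf : inner ℂ f (toeplitz (symbol φ hφ) f) = 0) :
    ∀ᵐ z ∂diskArea, φ z * (f : Lp ℂ 2 diskArea) z = 0 := by
  set F : Lp ℂ 2 diskArea := (f : Lp ℂ 2 diskArea) with hF
  rw [inner_toeplitz, ← hF] at hf
  have hae : (fun z => (inner ℂ (F z) (mulOp (symbol φ hφ) F z) : ℂ).re) =ᵐ[diskArea]
      fun z => (φ z).re * ‖F z‖ ^ 2 := by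
    filter_upwards [coeFn_mulOp_symbol φ hφ F] with z hz
    rw [hz, RCLike.inner_apply, mul_assoc, Complex.mul_conj, Complex.re_mul_ofReal,
      Complex.normSq_eq_norm_sq]
  have hi : Integrable (fun z => (inner ℂ (F z) (mulOp (symbol φ hφ) F z) : ℂ)) diskArea :=
    L2.integrable_inner F _
  have h0 : ∫ z, (φ z).re * ‖F z‖ ^ 2 ∂diskArea = 0 := by
    rw [← integral_congr_ae hae]
    have := integral_re hi
    simp only [RCLike.re_to_complex] at this
    rw [this, ← L2.inner_def, hf, Complex.zero_re]
  have hnn : 0 ≤ᵐ[diskArea] fun z => (φ z).re * ‖F z‖ ^ 2 := by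
    filter_upwards [ae_mem_ball] with z hz
    exact mul_nonneg ((sq_nonneg _).trans (hcond z hz)) (sq_nonneg _)
  rw [integral_eq_zero_iff_of_nonneg_ae hnn (hi.re.congr hae)] at h0
  filter_upwards [h0, ae_mem_ball] with z hz hzb
  rcases mul_eq_zero.1 hz with h | h
  · have him : (φ z).im = 0 := by
      have := hcond z hzb
      rw [h] at this
      exact abs_eq_zero.1 (pow_eq_zero_iff two_ne_zero |>.1 (this.antisymm (sq_nonneg _)))
    rw [Complex.ext (z := φ z) (w := 0) h him, zero_mul]
  · rw [norm_eq_zero.1 (pow_eq_zero_iff two_ne_zero |>.1 h), mul_zero]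

/-- A continuous function which annihilates a nonzero holomorphic function is zero. -/
theorem eqOn_zero_of_mul_ae_eq_zero {φ : ℂ → ℂ} (hφ : ContinuousOn φ (ball 0 1))
    {f : bergmanSpace} (hf0 : f ≠ 0)
    (h : ∀ᵐ z ∂diskArea, φ z * (f : Lp ℂ 2 diskArea) z = 0) : EqOn φ 0 (ball 0 1) := by
  obtain ⟨g, hg, hfg⟩ := f.2
  have hmul : EqOn (fun z => φ z * g z) 0 (ball 0 1) := by
    -- Both sides are continuous and nonempty open sets have positive area, so an almost everywhere
    -- identity holds at every point.
    refine Measure.eqOn_of_ae_eq (μ := volume) ?_ (hφ.mul hg.continuousOn) continuousOn_const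
      (by rw [isOpen_ball.interior_eq]; exact subset_closure)
    refine ae_diskArea_iff.1 ?_
    filter_upwards [h, hfg] with z h1 h2
    rw [← h2, h1, Pi.zero_apply]
  have hgan : AnalyticOnNhd ℂ g (ball 0 1) := hg.analyticOnNhd isOpen_ball
  rcases hgan.eqOn_zero_or_eventually_ne_zero_of_preconnected
    (convex_ball 0 1).isPreconnected with h0 | hne
  · refine absurd (Subtype.ext (Lp.ext ?_)) hf0
    filter_upwards [hfg, ae_mem_ball, Lp.coeFn_zero ℂ 2 diskArea] with z h1 h2 h3
    rw [h1, h0 h2]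
    exact h3.symm
  · intro z hz
    have hφz : ContinuousAt φ z := hφ.continuousAt (isOpen_ball.mem_nhds hz)
    have hgz : ∀ᶠ w in 𝓝[≠] z, g w ≠ 0 := by
      filter_upwards [disjoint_principal_right.1 (mem_codiscreteWithin.1 hne z hz),
        nhdsWithin_le_nhds (isOpen_ball.mem_nhds hz)] with w h1 h2 h3
      exact h1 ⟨h2, fun h4 => h4 h3⟩
    have hev : ∀ᶠ w in 𝓝[≠] z, φ w = 0 := by
      filter_upwards [hgz, nhdsWithin_le_nhds (isOpen_ball.mem_nhds hz)] with w h1 h2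
      exact (mul_eq_zero.1 (hmul h2)).resolve_right h1
    -- The limit through the punctured neighbourhood gives `φ z = 0` even when `g z = 0`.
    exact tendsto_nhds_unique (hφz.tendsto.mono_left nhdsWithin_le_nhds)
      (tendsto_const_nhds.congr' (hev.mono fun _ => Eq.symm))

/-! ### Infinite dimension of the Bergman space, and Fredholm operators -/

theorem memLp_polynomial (p : Polynomial ℂ) : MemLp (fun z => p.eval z) 2 diskArea :=
  (memLp_top_of_continuousOn p.continuous.continuousOn).mono_exponent le_top

/-- The inclusion of the polynomials into the Bergman space. -/
def polynomialToBergman : Polynomial ℂ →ₗ[ℂ] bergmanSpace where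
  toFun p := ⟨(memLp_polynomial p).toLp _, fun z => p.eval z,
    p.differentiable.differentiableOn, MemLp.coeFn_toLp _⟩
  map_add' p q := by
    refine Subtype.ext (Lp.ext ?_)
    simp only [Submodule.coe_add]
    filter_upwards [(memLp_polynomial (p + q)).coeFn_toLp, (memLp_polynomial p).coeFn_toLp,
      (memLp_polynomial q).coeFn_toLp,
      Lp.coeFn_add ((memLp_polynomial p).toLp _) ((memLp_polynomial q).toLp _)] with z h1 h2 h3 h4
    rw [h1, h4, Pi.add_apply, h2, h3, Polynomial.eval_add]
  map_smul' c p := by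
    refine Subtype.ext (Lp.ext ?_)
    simp only [Submodule.coe_smul, RingHom.id_apply]
    filter_upwards [(memLp_polynomial (c • p)).coeFn_toLp, (memLp_polynomial p).coeFn_toLp,
      Lp.coeFn_smul c ((memLp_polynomial p).toLp _)] with z h1 h2 h3
    rw [h1, h3, Pi.smul_apply, h2, Polynomial.eval_smul]

/-- A polynomial that is zero almost everywhere is zero on the whole disc by continuity, so it has
infinitely many roots. -/
theorem polynomialToBergman_injective : Function.Injective polynomialToBergman := by
  rw [← LinearMap.ker_eq_bot, LinearMap.ker_eq_bot']
  intro p hp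
  have h : (fun z => p.eval z) =ᵐ[diskArea] 0 := by
    have h1 : (memLp_polynomial p).toLp _ = 0 := congrArg Subtype.val hp
    exact (memLp_polynomial p).coeFn_toLp.symm.trans (h1 ▸ Lp.coeFn_zero ℂ 2 diskArea)
  have h' : EqOn (fun z => p.eval z) 0 (ball 0 1) :=
    Measure.eqOn_of_ae_eq (μ := volume) (ae_diskArea_iff.1 h) p.continuous.continuousOn
      continuousOn_const (by rw [isOpen_ball.interior_eq]; exact subset_closure)
  refine p.eq_zero_of_infinite_isRoot (Infinite.mono (fun z hz => h' hz) ?_)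
  exact infinite_of_mem_nhds 0 (ball_mem_nhds 0 one_pos)

theorem not_finiteDimensional_bergmanSpace : ¬ FiniteDimensional ℂ bergmanSpace := fun _ =>
  Polynomial.not_finite (R := ℂ) (Module.Finite.of_injective _ polynomialToBergman_injective)

/-- The kernel is all of `A²`, which is too large for a Fredholm operator. -/
theorem not_isFredholm_zero : ¬ (0 : bergmanSpace →L[ℂ] bergmanSpace).IsFredholm := fun h => by
  have h1 := h.finite_ker
  have h2 : (0 : bergmanSpace →L[ℂ] bergmanSpace).ker = ⊤ := LinearMap.ker_zero
  rw [h2] at h1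
  exact not_finiteDimensional_bergmanSpace (Module.finite_def.2 ((Submodule.fg_iff_finiteDimensional _).2 h1))

/-- Values on the unit circle play no role, since `diskArea` is carried by the open disc. -/
theorem toeplitz_symbol_eq_zero {φ : ℂ → ℂ} (hφ : ContinuousOn φ (closedBall 0 1))
    (h : EqOn φ 0 (ball 0 1)) : toeplitz (symbol φ hφ) = 0 := by
  have h0 : symbol φ hφ = 0 := by
    refine Lp.ext ?_
    filter_upwards [coeFn_symbol φ hφ, Lp.coeFn_zero ℂ ∞ diskArea, ae_mem_ball] with z h1 h2 h3
    rw [h1, h2, h h3]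
  rw [h0, toeplitz, mulOp, map_zero, ContinuousLinearMap.zero_comp, ContinuousLinearMap.comp_zero]

theorem isFredholm_of_isUnit {E : Type*} [NormedAddCommGroup E] [NormedSpace ℂ E]
    {T : E →L[ℂ] E} (hT : IsUnit T) : T.IsFredholm := by
  obtain ⟨u, rfl⟩ := hT
  exact .of_isQuasiInverse (v := ((u⁻¹ : (E →L[ℂ] E)ˣ) : E →L[ℂ] E))
    (ContinuousLinearEquiv.unitsEquiv ℂ E u).toLinearEquiv.isQuasiInverse

end BergmanToeplitz

end

theorem theorem5p6 (φ : ℂ → ℂ) (hφ : ContinuousOn φ (Metric.closedBall 0 1))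
    (hAQ : BergmanToeplitz.symbol φ hφ ∈ BergmanToeplitz.AQ)
    (hcond : ∀ z ∈ Metric.ball (0 : ℂ) 1, |(φ z).im| ^ 2 ≤ (φ z).re) :
    IsUnit (BergmanToeplitz.toeplitz (BergmanToeplitz.symbol φ hφ)) ↔
      (BergmanToeplitz.toeplitz (BergmanToeplitz.symbol φ hφ)).IsFredholm := by
  open BergmanToeplitz in
  refine ⟨isFredholm_of_isUnit, fun hFr => ?_⟩
  set T := toeplitz (symbol φ hφ) with hT
  -- The form is definite: a nonzero `f` at which it vanishes would make `T` the zero operator.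
  have key : ∀ f : bergmanSpace, inner ℂ f (T f) = 0 → f = 0 := by
    intro f hf
    by_contra hf0
    have h0 := eqOn_zero_of_mul_ae_eq_zero (hφ.mono Metric.ball_subset_closedBall) hf0
      (mul_ae_eq_zero_of_inner_toeplitz_eq_zero hφ hcond hf)
    rw [hT, toeplitz_symbol_eq_zero hφ h0] at hFr
    exact not_isFredholm_zero hFr
  rw [ContinuousLinearMap.isUnit_iff_bijective]
  constructor
  · exact (injective_iff_map_eq_zero T).2 fun f hf => key f (by rw [hf, inner_zero_right])
  -- Closedness of the range, supplied by Fredholmness, lets a trivial orthogonal complement imply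
  -- surjectivity.
  · have : CompleteSpace T.range := hFr.isClosed_range.completeSpace_coe
    refine (LinearMap.range_eq_top (f := T.toLinearMap)).1 ?_
    refine (Submodule.orthogonal_eq_bot_iff (K := T.range)).1 ((Submodule.eq_bot_iff _).2 ?_)
    intro g hg
    -- A vector `g` orthogonal to the range is in particular orthogonal to `T g`.
    exact key g ((Submodule.mem_orthogonal' _ g).1 hg _ ⟨g, rfl⟩)
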